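/- Let $K$ be a number field, let $\overline{\mathbb{Q}}$ be an algebraic closure of $\mathbb{Q}$ containing $K$, and let $F$ be a field with $K\subseteq F\subseteq\overline{\mathbb{Q}}$. Let $\mathcal{G}$ be either the multiplicative group $\mathbb{G}_m$ or an elliptic curve defined over $K$. The canonical height on $\mathcal{G}(\overline{\mathbb{Q}})$ is the absolute logarithmic Weil height $h$ if $\mathcal{G}=\mathbb{G}_m$, and the Néron–Tate height $\widehat{h}(P)=\lim_{n\to\infty}4^{-n}h(x(2^nP))$ if $\mathcal{G}$ is an elliptic curve, where $x$ is the $x$-coordinate of a Weierstrass model over $K$ and $h(x(O))=0$ by convention. Suppose that $F$ has the Bogomolov property with respect to $\mathcal{G}$, that is, there exists $\epsilon>0$ such that every non-torsion point of $\mathcal{G}(F)$ has canonical height at least $\epsilon$. Then the quotient $\mathcal{G}(F)/\mathcal{G}(F)_{\mathrm{tors}}$ of $\mathcal{G}(F)$ by its torsion subgroup is a free abelian group. -/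

import Mathlib

noncomputable section

/-- The naive (absolute, logarithmic) height `h(x(P))` of a point `P` on a Weierstrass curve over a
field of algebraic numbers; the point at infinity has height `0`. -/
def naiveHeight {L : Type*} [Field L] [CharZero L] {W : WeierstrassCurve L} :
    W.toAffine.Point → ℝ
  | .zero => 0
  | .some x _ _ => NumberField.absLogHeight₁ x

/-- The Néron–Tate height `lim 4⁻ⁿ h(x(2ⁿ P))`, normalized with respect to the divisor `2(O)`
(so it is the limit itself, not one half of it). -/
def neronTateHeight {L : Type*} [Field L] [CharZero L] [DecidableEq L] {W : WeierstrassCurve L}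
    (P : W.toAffine.Point) : ℝ :=
  Filter.limUnder Filter.atTop fun n : ℕ ↦ naiveHeight ((2 ^ n : ℕ) • P) / 4 ^ n

/-- The Bogomolov property of a field `F` of algebraic numbers with respect to `𝔾ₘ`: the absolute
logarithmic Weil height of the elements of `Fˣ` that are not roots of unity is bounded below by a
positive constant. -/
def BogomolovGm {K Qbar : Type*} [Field K] [Field Qbar] [CharZero Qbar] [Algebra K Qbar]
    (F : IntermediateField K Qbar) : Prop :=
  ∃ ε : ℝ, 0 < ε ∧ ∀ u : Fˣ, u ∉ CommGroup.torsion Fˣ →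
    ε ≤ NumberField.absLogHeight₁ ((u : F) : Qbar)

/-- The Bogomolov property of a field `F` of algebraic numbers with respect to an elliptic curve
`E` over a subfield `K` of `F`: the Néron–Tate height of the non-torsion points of `E(F)`, regarded
as points over the algebraic closure, is bounded below by a positive constant. -/
def BogomolovElliptic {K Qbar : Type*} [Field K] [Field Qbar] [CharZero Qbar] [DecidableEq Qbar]
    [Algebra K Qbar] (E : WeierstrassCurve K) (F : IntermediateField K Qbar) : Prop :=
  ∃ ε : ℝ, 0 < ε ∧ ∀ P : (E.baseChange F).toAffine.Point,
    P ∉ AddCommGroup.torsion (E.baseChange F).toAffine.Point →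
      ε ≤ neronTateHeight (WeierstrassCurve.Affine.Point.map (W' := E) F.val P)

end

/-! The canonical height induces on $A=\mathcal{G}(F)/\mathcal{G}(F)_{\mathrm{tors}}$ a function `N`
that is homogeneous of degree `k`, satisfies `N (x + y) ≤ C * (N x + N y)`, and is at least `ε` off
`0`. Since `A` is countable, Pontryagin's criterion (`Module.free_of_countable_of_fg_saturation`)
reduces freeness to finite generation of the saturation of each finitely generated subgroup. Modulo
that subgroup, an element of the saturation has rational coordinates in $[0,1)$ with respect to the
generators. Two elements with close coordinates differ by an element of height below `ε`, so they
coincide, and finitely many representatives suffice (`Submodule.fg_saturation_span_of_discrete`).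

For $\mathbb{G}_m$, `C = k = 1`. For an elliptic curve, `C = k = 2`, both from the parallelogram
law: the formulas for $x(P\pm Q)$ give it for the naive height up to a bounded error over each
number field, and the limit removes the error. Compatibility of heights with field extensions
carries this to `Qbar`. -/

/-! ### Saturated subgroups and Pontryagin's criterion -/

/-- The elements of an abelian group that have a nonzero multiple in `M`. -/
def Submodule.saturation {A : Type*} [AddCommGroup A] (M : Submodule ℤ A) : Submodule ℤ A where
  carrier := {x | ∃ n : ℕ, 0 < n ∧ (n : ℤ) • x ∈ M}
  add_mem' := by
    rintro x y ⟨n, hn, hx⟩ ⟨m, hm, hy⟩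
    refine ⟨n * m, Nat.mul_pos hn hm, ?_⟩
    have h : ((n * m : ℕ) : ℤ) • (x + y) = (m : ℤ) • (n : ℤ) • x + (n : ℤ) • (m : ℤ) • y := by
      push_cast
      module
    rw [h]
    exact M.add_mem (M.smul_mem _ hx) (M.smul_mem _ hy)
  zero_mem' := ⟨1, one_pos, by simp⟩
  smul_mem' := by
    rintro c x ⟨n, hn, hx⟩
    refine ⟨n, hn, ?_⟩
    rw [smul_comm]
    exact M.smul_mem _ hx

namespace Submodule

variable {A : Type*} [AddCommGroup A]

theorem le_saturation (M : Submodule ℤ A) : M ≤ M.saturation :=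
  fun x hx ↦ ⟨1, one_pos, by simpa using hx⟩

theorem saturation_mono {M N : Submodule ℤ A} (h : M ≤ N) : M.saturation ≤ N.saturation :=
  fun _ ⟨n, hn, hx⟩ ↦ ⟨n, hn, h hx⟩

theorem mem_saturation_of_smul_mem {M : Submodule ℤ A} {x : A} {n : ℤ} (hn : n ≠ 0)
    (hx : n • x ∈ M.saturation) : x ∈ M.saturation := by
  obtain ⟨m, hm, h⟩ := hx
  refine ⟨m * n.natAbs, Nat.mul_pos hm (Int.natAbs_pos.mpr hn), ?_⟩
  push_cast
  rcases abs_choice n with h' | h' <;> rw [h']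
  · rwa [mul_smul]
  · rw [mul_neg, neg_smul, mul_smul]
    exact M.neg_mem h

/-- A submodule that is closed under division by nonzero integers has a complement in any finitely
generated submodule containing it. -/
theorem exists_free_complement_of_saturated {M N : Submodule ℤ A} (hMN : M ≤ N) (hN : N.FG)
    (hM : ∀ (n : ℤ) (x : A), n ≠ 0 → n • x ∈ M → x ∈ M) :
    ∃ C : Submodule ℤ A, Module.Free ℤ C ∧ Disjoint M C ∧ M ⊔ C = N := by
  have : Module.Finite ℤ N := Module.Finite.iff_fg.mpr hN
  let M' : Submodule ℤ N := M.comap N.subtype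
  -- Saturation makes the quotient torsion-free, hence free over ℤ; a section of the projection then
  -- gives the complement.
  have : Module.IsTorsionFree ℤ (N ⧸ M') := by
    rw [Module.isTorsionFree_iff_smul_eq_zero]
    intro n q hq
    induction q using Submodule.Quotient.induction_on with | _ x
    rw [or_iff_not_imp_left]
    intro hn
    rw [← Submodule.Quotient.mk_smul, Submodule.Quotient.mk_eq_zero] at hq
    rw [Submodule.Quotient.mk_eq_zero]
    exact hM n x hn hq
  have : Module.Free ℤ (N ⧸ M') := inferInstance
  obtain ⟨s, hs⟩ := M'.mkQ.exists_rightInverse_of_surjective M'.range_mkQ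
  have hs' (q) : M'.mkQ (s q) = q := LinearMap.congr_fun hs q
  have hinj : Function.Injective (N.subtype ∘ₗ s) :=
    N.injective_subtype.comp (Function.LeftInverse.injective hs')
  refine ⟨LinearMap.range (N.subtype ∘ₗ s),
    Module.Free.of_equiv (LinearEquiv.ofInjective _ hinj), ?_, le_antisymm ?_ ?_⟩
  · rw [Submodule.disjoint_def]
    rintro _ hx ⟨q, rfl⟩
    have : M'.mkQ (s q) = 0 := (Submodule.Quotient.mk_eq_zero _).mpr hx
    rw [hs'] at this
    simp [this]
  · refine sup_le hMN ?_
    rintro _ ⟨q, rfl⟩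
    exact (s q).2
  · intro x hx
    let x' : N := ⟨x, hx⟩
    have h : x' - s (M'.mkQ x') ∈ M' := by
      rw [← Submodule.Quotient.mk_eq_zero, ← Submodule.mkQ_apply, map_sub, hs', sub_self]
    have : x = ((x' - s (M'.mkQ x') : N) : A) + (s (M'.mkQ x') : A) := by simp [x']
    rw [this]
    exact Submodule.add_mem_sup h ⟨_, rfl⟩

end Submodule

/-- A countable torsion-free abelian group is free if the saturation of every finitely generated
subgroup is finitely generated (**Pontryagin's criterion**). -/
theorem Module.free_of_countable_of_fg_saturation {A : Type*} [AddCommGroup A] [Countable A]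
    [Module.IsTorsionFree ℤ A]
    (hfg : ∀ s : Finset A, (Submodule.span ℤ (s : Set A)).saturation.FG) : Module.Free ℤ A := by
  classical
  obtain ⟨f, hf⟩ := exists_surjective_nat A
  let G (n : ℕ) : Submodule ℤ A :=
    (Submodule.span ℤ (((Finset.range n).image f : Finset A) : Set A)).saturation
  have hGmono : Monotone G := fun m n h ↦ Submodule.saturation_mono <| Submodule.span_mono <| by
    exact_mod_cast Finset.image_subset_image (Finset.range_mono h)
  have hG0 : G 0 = ⊥ := by
    rw [eq_bot_iff]
    rintro x ⟨n, hn, hx⟩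
    have hx' : (n : ℤ) • x = 0 := by simpa using hx
    exact (smul_eq_zero.mp hx').resolve_left (by exact_mod_cast hn.ne')
  have hmem (n : ℕ) : f n ∈ G (n + 1) :=
    Submodule.le_saturation _ (Submodule.subset_span (by simpa using ⟨n, le_rfl, rfl⟩))
  have hC (n : ℕ) := Submodule.exists_free_complement_of_saturated (hGmono n.le_succ) (hfg _)
    fun m x hm hx ↦ Submodule.mem_saturation_of_smul_mem hm hx
  choose C hCfree hCdisj hCsup using hC
  have hsup (n : ℕ) : ⨆ i < n, C i = G n := by
    induction n with
    | zero => simp [hG0]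
    | succ n ih => rw [← hCsup, ← ih, Nat.iSup_lt_succ]
  have hind : iSupIndep C := by
    rw [iSupIndep_iff_supIndep]
    intro t
    induction t using Finset.induction_on_max with
    | empty => exact Finset.supIndep_empty _
    | insert n t hlt ih =>
      refine ih.insert ((hCdisj n).symm.mono_right (Finset.sup_le fun i hi ↦ ?_))
      rw [← hsup]
      exact le_iSup₂_of_le i (hlt i hi) le_rfl
  have htop : iSup C = ⊤ := by
    rw [eq_top_iff]
    intro x _
    obtain ⟨n, rfl⟩ := hf x
    have h := hmem n
    rw [← hsup] at h
    exact (iSup₂_le fun i _ ↦ le_iSup C i : ⨆ i < n + 1, C i ≤ iSup C) h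
  have hint := DirectSum.isInternal_submodule_of_iSupIndep_of_iSup_eq_top hind htop
  exact Module.Free.of_equiv (LinearEquiv.ofBijective (DirectSum.coeLinearMap C) hint)

/-! ### Groups with a discrete homogeneous height -/

section DiscreteHeight

variable {A : Type*} [AddCommGroup A]

theorem le_pow_card_mul_sum_of_add_le {N : A → ℝ} {C : ℝ} (hC : 1 ≤ C) (h0 : N 0 = 0)
    (hnonneg : ∀ x, 0 ≤ N x) (hadd : ∀ x y, N (x + y) ≤ C * (N x + N y))
    {ι : Type*} (t : Finset ι) (f : ι → A) :
    N (∑ i ∈ t, f i) ≤ C ^ t.card * ∑ i ∈ t, N (f i) := by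
  classical
  induction t using Finset.induction_on with
  | empty => simp [h0]
  | insert i t hi ih =>
    rw [Finset.sum_insert hi, Finset.sum_insert hi, Finset.card_insert_of_notMem hi]
    have h1 : (1 : ℝ) ≤ C ^ t.card := one_le_pow₀ hC
    calc N (f i + ∑ i ∈ t, f i) ≤ C * (N (f i) + N (∑ i ∈ t, f i)) := hadd _ _
      _ ≤ C * (C ^ t.card * N (f i) + C ^ t.card * ∑ i ∈ t, N (f i)) := by
        gcongr
        exact le_mul_of_one_le_left (hnonneg _) h1
      _ = _ := by ring

/-- A function on an abelian group that is homogeneous of positive degree, subadditive up to a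
constant factor, and bounded away from `0` outside the origin makes every subgroup of finite rank
finitely generated. -/
theorem Submodule.fg_saturation_span_of_discrete {N : A → ℝ} {C ε : ℝ} {k : ℕ} (hC : 1 ≤ C)
    (hε : 0 < ε) (hk : k ≠ 0) (hnonneg : ∀ x, 0 ≤ N x)
    (hadd : ∀ x y, N (x + y) ≤ C * (N x + N y))
    (hsmul : ∀ (n : ℤ) x, N (n • x) = |(n : ℝ)| ^ k * N x) (hdisc : ∀ x, x ≠ 0 → ε ≤ N x)
    (s : Finset A) : (Submodule.span ℤ (s : Set A)).saturation.FG := by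
  classical
  have h0 : N 0 = 0 := by simpa [hk] using hsmul 0 0
  -- `c` gives rational coordinates of `x`. This is a relation, not a function, because `s` may be
  -- linearly dependent.
  let R (x : A) (c : A → ℝ) : Prop := ∃ n : ℕ, 0 < n ∧ ∃ a : A → ℤ,
    (n : ℤ) • x = ∑ i ∈ s, a i • i ∧ ∀ i, c i = a i / n
  have hRN (x : A) (c : A → ℝ) (h : R x c) :
      N x ≤ C ^ s.card * ∑ i ∈ s, |c i| ^ k * N i := by
    obtain ⟨n, hn, a, hx, hc⟩ := h
    have hn' : (0 : ℝ) < n := by exact_mod_cast hn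
    have h := le_pow_card_mul_sum_of_add_le hC h0 hnonneg hadd s fun i ↦ a i • i
    rw [← hx, hsmul] at h
    simp only [hsmul, Int.cast_natCast, Nat.abs_cast] at h
    rw [← mul_le_mul_iff_of_pos_left (pow_pos hn' k)]
    refine h.trans_eq ?_
    rw [mul_left_comm]
    congr 1
    rw [Finset.mul_sum]
    refine Finset.sum_congr rfl fun i _ ↦ ?_
    rw [← mul_assoc, ← mul_pow, hc, abs_div, Nat.abs_cast, mul_div_cancel₀ _ hn'.ne']
  have hRsub (x y : A) (c d : A → ℝ) (hx : R x c) (hy : R y d) : R (x - y) (c - d) := by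
    obtain ⟨n, hn, a, hx, hc⟩ := hx
    obtain ⟨m, hm, b, hy, hd⟩ := hy
    have hn' : (n : ℝ) ≠ 0 := by exact_mod_cast hn.ne'
    have hm' : (m : ℝ) ≠ 0 := by exact_mod_cast hm.ne'
    refine ⟨n * m, Nat.mul_pos hn hm, fun i ↦ m * a i - n * b i, ?_, fun i ↦ ?_⟩
    · have : ((n * m : ℕ) : ℤ) • (x - y) = (m : ℤ) • (n : ℤ) • x - (n : ℤ) • (m : ℤ) • y := by
        push_cast
        module
      rw [this, hx, hy, Finset.smul_sum, Finset.smul_sum, ← Finset.sum_sub_distrib]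
      simp only [sub_smul, mul_smul]
    · simp only [Pi.sub_apply, hc, hd]
      push_cast
      field_simp
  let Y : Set A := {x | ∃ c, R x c ∧ ∀ i, c i ∈ Set.Ico (0 : ℝ) 1}
  have hred (x : A) (hx : x ∈ (Submodule.span ℤ (s : Set A)).saturation) :
      ∃ y ∈ Y, x - y ∈ Submodule.span ℤ (s : Set A) := by
    obtain ⟨n, hn, hx⟩ := hx
    obtain ⟨a, -, ha⟩ := Submodule.mem_span_finset.mp hx
    have hn' : (0 : ℝ) < n := by exact_mod_cast hn
    refine ⟨x - ∑ i ∈ s, (a i / n) • i, ⟨fun i ↦ (a i % n : ℤ) / n, ⟨n, hn, fun i ↦ a i % n, ?_,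
      fun i ↦ rfl⟩, fun i ↦ ⟨?_, ?_⟩⟩, ?_⟩
    · rw [smul_sub, ← ha, Finset.smul_sum, ← Finset.sum_sub_distrib]
      refine Finset.sum_congr rfl fun i _ ↦ ?_
      rw [← mul_smul, ← sub_smul]
      simp only [Int.emod_def]
    · have : 0 ≤ a i % n := Int.emod_nonneg _ (by exact_mod_cast hn.ne')
      have : (0 : ℝ) ≤ (a i % n : ℤ) := by exact_mod_cast this
      positivity
    · rw [div_lt_one hn']
      exact_mod_cast Int.emod_lt_of_pos (a i) (by exact_mod_cast hn)
    · rw [sub_sub_cancel]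
      exact Submodule.sum_mem _ fun i hi ↦ Submodule.smul_mem _ _ (Submodule.subset_span hi)
  have hYsat (y : A) (hy : y ∈ Y) : y ∈ (Submodule.span ℤ (s : Set A)).saturation := by
    obtain ⟨c, ⟨n, hn, a, h, -⟩, -⟩ := hy
    refine ⟨n, hn, ?_⟩
    rw [h]
    exact Submodule.sum_mem _ fun i hi ↦ Submodule.smul_mem _ _ (Submodule.subset_span hi)
  have hYfin : Y.Finite := by
    -- Pigeonhole: cut the unit cube into boxes of side `1 / M`, with `M` so large that two points
    -- of `Y` in one box differ by an element of height below `ε`.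
    obtain ⟨M, hM⟩ := exists_nat_gt (C ^ s.card * (∑ i ∈ s, N i) / ε)
    have hS : 0 ≤ ∑ i ∈ s, N i := Finset.sum_nonneg fun i _ ↦ hnonneg i
    have hM0 : (0 : ℝ) < M := lt_of_le_of_lt (by positivity) hM
    rw [div_lt_iff₀ hε] at hM
    let box (y : A) (i : s) : ℕ :=
      if h : ∃ c, R y c ∧ ∀ i, c i ∈ Set.Ico (0 : ℝ) 1 then ⌊M * h.choose i⌋₊ else 0
    refine Set.Finite.of_finite_image (f := box) ?_ ?_
    · refine (Set.Finite.pi' fun _ ↦ Set.finite_Iio M).subset ?_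
      rintro _ ⟨y, hy, rfl⟩ i
      have hy' : ∃ c, R y c ∧ ∀ i, c i ∈ Set.Ico (0 : ℝ) 1 := hy
      simp only [box, dif_pos hy', Set.mem_Iio]
      rw [Nat.floor_lt (mul_nonneg hM0.le (hy'.choose_spec.2 i).1)]
      exact mul_lt_of_lt_one_right hM0 (hy'.choose_spec.2 i).2
    · intro y hy z hz hyz
      have hy' : ∃ c, R y c ∧ ∀ i, c i ∈ Set.Ico (0 : ℝ) 1 := hy
      have hz' : ∃ c, R z c ∧ ∀ i, c i ∈ Set.Ico (0 : ℝ) 1 := hz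
      by_contra hne
      have h := (hdisc _ (sub_ne_zero.mpr hne)).trans
        (hRN _ _ (hRsub _ _ _ _ hy'.choose_spec.1 hz'.choose_spec.1))
      refine h.not_gt ?_
      have hbd (i : A) (hi : i ∈ s) :
          |(hy'.choose - hz'.choose) i| ^ k * N i ≤ 1 / M * N i := by
        gcongr
        · exact hnonneg i
        have hb := congrFun hyz ⟨i, hi⟩
        simp only [box, dif_pos hy', dif_pos hz'] at hb
        have h1 : |hy'.choose i - hz'.choose i| ≤ 1 / M := by
          rw [le_div_iff₀ hM0, ← Nat.abs_cast M, ← abs_mul]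
          have e1 := Nat.floor_le (mul_nonneg hM0.le (hy'.choose_spec.2 i).1)
          have e2 := Nat.lt_floor_add_one (M * hy'.choose i)
          have e3 := Nat.floor_le (mul_nonneg hM0.le (hz'.choose_spec.2 i).1)
          have e4 := Nat.lt_floor_add_one (M * hz'.choose i)
          rw [hb] at e1 e2
          rw [abs_le]
          constructor <;> linarith
        have h2 : (1 : ℝ) / M ≤ 1 := by
          rw [div_le_one hM0]
          exact_mod_cast Nat.one_le_iff_ne_zero.mpr (by rintro rfl; simp at hM0)
        exact (pow_le_of_le_one (abs_nonneg _) (h1.trans h2) hk).trans h1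
      calc C ^ s.card * ∑ i ∈ s, |(hy'.choose - hz'.choose) i| ^ k * N i
          ≤ C ^ s.card * ∑ i ∈ s, 1 / M * N i := by
            exact mul_le_mul_of_nonneg_left (Finset.sum_le_sum hbd) (by positivity)
        _ = (C ^ s.card * ∑ i ∈ s, N i) / M := by rw [← Finset.mul_sum]; ring
        _ < ε := by rwa [div_lt_iff₀ hM0, mul_comm ε]
  have heq : (Submodule.span ℤ (s : Set A)).saturation = Submodule.span ℤ ((s : Set A) ∪ Y) := by
    refine le_antisymm (fun x hx ↦ ?_) (Submodule.span_le.mpr (Set.union_subset ?_ hYsat))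
    · obtain ⟨y, hy, hxy⟩ := hred x hx
      rw [← sub_add_cancel x y]
      exact Submodule.add_mem _ (Submodule.span_mono Set.subset_union_left hxy)
        (Submodule.subset_span (Or.inr hy))
    · exact Submodule.subset_span.trans (Submodule.le_saturation _)
  rw [heq]
  exact Submodule.fg_span (s.finite_toSet.union hYfin)

/-- A countable abelian group with a discrete homogeneous height is free modulo torsion. -/
theorem Module.free_of_discrete_height {G : Type*} [AddCommGroup G] [Countable G] (π : G →+ A)
    (hπ : Function.Surjective π) (hker : ∀ g, π g = 0 → IsOfFinAddOrder g)
    {N : G → ℝ} {C ε : ℝ} {k : ℕ} (hC : 1 ≤ C) (hε : 0 < ε) (hk : k ≠ 0)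
    (hnonneg : ∀ x, 0 ≤ N x) (hadd : ∀ x y, N (x + y) ≤ C * (N x + N y))
    (hsmul : ∀ (n : ℤ) x, N (n • x) = |(n : ℝ)| ^ k * N x)
    (hdisc : ∀ x, π x ≠ 0 → ε ≤ N x) : Module.Free ℤ A := by
  -- Homogeneity makes `N` blind to torsion, so it descends along `π`.
  have hcongr (g g' : G) (h : π g = π g') : N g = N g' := by
    obtain ⟨n, hn, hz⟩ := (hker (g - g') (by rw [map_sub, h, sub_self])).exists_nsmul_eq_zero
    have hng : (n : ℤ) • g = (n : ℤ) • g' := by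
      rw [← sub_eq_zero, ← smul_sub, natCast_zsmul, hz]
    have h1 := hsmul n g
    rw [hng, hsmul] at h1
    have hn' : |((n : ℤ) : ℝ)| ^ k ≠ 0 := by
      simpa using fun h ↦ absurd h (by exact_mod_cast hn.ne')
    exact (mul_left_cancel₀ hn' h1).symm
  let N' (a : A) : ℝ := N (Function.surjInv hπ a)
  have hN' (g : G) : N' (π g) = N g := hcongr _ _ (Function.surjInv_eq hπ _)
  have : Countable A := hπ.countable
  have hsmul' (n : ℤ) (a : A) : N' (n • a) = |(n : ℝ)| ^ k * N' a := by
    obtain ⟨g, rfl⟩ := hπ a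
    rw [← map_zsmul, hN', hN', hsmul]
  have hdisc' (a : A) (ha : a ≠ 0) : ε ≤ N' a := by
    obtain ⟨g, rfl⟩ := hπ a
    rw [hN']
    exact hdisc g ha
  have : Module.IsTorsionFree ℤ A := by
    rw [Module.isTorsionFree_iff_smul_eq_zero]
    intro n a h
    by_contra! hne
    have h1 := hsmul' n a
    have h0 : N' 0 = 0 := by simpa [hk] using hsmul' 0 0
    rw [h, h0, eq_comm, mul_eq_zero] at h1
    rcases h1 with h1 | h1
    · exact hne.1 (by simpa using pow_eq_zero_iff hk |>.mp h1)
    · exact (hε.trans_le (hdisc' a hne.2)).ne' h1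
  refine Module.free_of_countable_of_fg_saturation
    (Submodule.fg_saturation_span_of_discrete (N := N') hC hε hk (fun _ ↦ hnonneg _) ?_ hsmul'
      hdisc')
  intro a b
  obtain ⟨g, rfl⟩ := hπ a
  obtain ⟨h, rfl⟩ := hπ b
  rw [← map_add, hN', hN', hN']
  exact hadd g h

end DiscreteHeight

/-! ### Heights under extension of number fields -/

namespace NumberField

open Height

variable {K L : Type*} [Field K] [NumberField K] [Field L] [NumberField L] [Algebra K L]

/-- The multiplicity of a place is the number of complex embeddings inducing it. -/
theorem InfinitePlace.prod_pow_mult_eq_prod_embeddings {M : Type*} [CommMonoid M]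
    (f : InfinitePlace K → M) :
    ∏ v : InfinitePlace K, f v ^ v.mult = ∏ φ : K →+* ℂ, f (InfinitePlace.mk φ) := by
  classical
  rw [← Finset.prod_fiberwise Finset.univ InfinitePlace.mk (fun φ ↦ f (InfinitePlace.mk φ))]
  refine Finset.prod_congr rfl fun w _ ↦ ?_
  rw [← InfinitePlace.card_filter_mk_eq, ← Finset.prod_const]
  exact Finset.prod_congr rfl fun φ hφ ↦ by rw [(Finset.mem_filter.mp hφ).2]

/-- Each complex embedding of `K` has exactly `[L : K]` extensions to `L`. -/
theorem prod_embeddings_comp_algebraMap {M : Type*} [CommMonoid M] (f : (K →+* ℂ) → M) :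
    ∏ ψ : L →+* ℂ, f (ψ.comp (algebraMap K L)) =
      (∏ φ : K →+* ℂ, f φ) ^ Module.finrank K L := by
  classical
  rw [← Finset.prod_fiberwise Finset.univ (fun ψ : L →+* ℂ ↦ ψ.comp (algebraMap K L)),
    ← Finset.prod_pow]
  refine Finset.prod_congr rfl fun φ _ ↦ ?_
  have hcard : (Finset.univ.filter fun ψ : L →+* ℂ ↦ ψ.comp (algebraMap K L) = φ).card =
      Module.finrank K L := by
    let : Algebra K ℂ := φ.toAlgebra
    rw [← AlgHom.card K L ℂ, ← Fintype.card_subtype]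
    refine Fintype.card_congr
      { toFun := fun ψ ↦ { ψ.1 with commutes' := fun r ↦ RingHom.congr_fun ψ.2 r }
        invFun := fun σ ↦ ⟨σ.toRingHom, σ.comp_algebraMap⟩
        left_inv := fun ψ ↦ rfl
        right_inv := fun σ ↦ rfl }
  rw [← hcard, ← Finset.prod_const]
  exact Finset.prod_congr rfl fun ψ hψ ↦ by rw [(Finset.mem_filter.mp hψ).2]

/-- The finite part of the height is the inverse norm of the ideal generated by the coordinates, and
extending an ideal to `L` raises its norm to the power `[L : K]`. This avoids any analysis of places
above a given one. -/
theorem finprod_finitePlace_iSup_algebraMap {ι : Type*} [Finite ι] {x : ι → 𝓞 K} (hx : x ≠ 0) :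
    ∏ᶠ v : FinitePlace L, ⨆ i, v (algebraMap K L (x i)) =
      (∏ᶠ v : FinitePlace K, ⨆ i, v (x i : K)) ^ Module.finrank K L := by
  let y : ι → 𝓞 L := fun i ↦ algebraMap (𝓞 K) (𝓞 L) (x i)
  have hy : y ≠ 0 := by
    obtain ⟨i, hi⟩ := Function.ne_iff.mp hx
    refine Function.ne_iff.mpr ⟨i, ?_⟩
    simpa [y] using hi
  have h1 := absNorm_mul_finprod_finitePlace_eq_one hx
  have h2 := absNorm_mul_finprod_finitePlace_eq_one hy
  have hmap : Ideal.span (Set.range y) =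
      (Ideal.span (Set.range x)).map (algebraMap (𝓞 K) (𝓞 L)) := by
    rw [Ideal.map_span, ← Set.range_comp]
    rfl
  have hrank : Module.finrank (𝓞 K) (𝓞 L) = Module.finrank K L :=
    (IsFractionRing.finrank_eq (𝓞 K) K (𝓞 L) L).symm
  rw [hmap, Ideal.absNorm_algebraMap, hrank] at h2
  have h3 := congrArg (· ^ Module.finrank K L) h1
  simp only [mul_pow, one_pow] at h3
  push_cast at h2
  have hne : ((Ideal.span (Set.range x)).absNorm : ℝ) ^ Module.finrank K L ≠ 0 := by
    intro h
    rw [h, zero_mul] at h3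
    exact zero_ne_one h3
  exact mul_left_cancel₀ hne (h2.trans h3.symm)

/-- The height of a tuple of algebraic integers over an extension of number fields. -/
theorem mulHeight_algebraMap {ι : Type*} [Finite ι] {x : ι → 𝓞 K} (hx : x ≠ 0) :
    mulHeight (fun i ↦ algebraMap K L (x i)) =
      mulHeight (fun i ↦ (x i : K)) ^ Module.finrank K L := by
  obtain ⟨i, hi⟩ := Function.ne_iff.mp hx
  have hxK : (fun i ↦ (x i : K)) ≠ 0 := Function.ne_iff.mpr ⟨i, by simpa using hi⟩
  have hxL : (fun i ↦ algebraMap K L (x i)) ≠ 0 := Function.ne_iff.mpr ⟨i, by simpa using hi⟩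
  rw [mulHeight_eq hxK, mulHeight_eq hxL, mul_pow, finprod_finitePlace_iSup_algebraMap hx,
    InfinitePlace.prod_pow_mult_eq_prod_embeddings fun v ↦ ⨆ i, v (x i : K),
    InfinitePlace.prod_pow_mult_eq_prod_embeddings fun v ↦ ⨆ i, v (algebraMap K L (x i)),
    ← prod_embeddings_comp_algebraMap (L := L)]
  rfl

/-- The height over an extension of number fields. -/
theorem mulHeight₁_algebraMap (x : K) :
    mulHeight₁ (algebraMap K L x) = mulHeight₁ x ^ Module.finrank K L := by
  obtain ⟨a, b, hb, rfl⟩ := IsFractionRing.div_surjective (𝓞 K) x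
  have hab : ![a, b] ≠ 0 := Function.ne_iff.mpr ⟨1, by simpa using nonZeroDivisors.ne_zero hb⟩
  have h := mulHeight_algebraMap (L := L) hab
  rw [map_div₀, mulHeight₁_div_eq_mulHeight, mulHeight₁_div_eq_mulHeight]
  have hK : (fun i ↦ ((![a, b] i : 𝓞 K) : K)) = ![algebraMap (𝓞 K) K a, algebraMap (𝓞 K) K b] := by
    ext i
    fin_cases i <;> rfl
  have hL : (fun i ↦ algebraMap K L (![a, b] i : 𝓞 K)) =
      ![algebraMap K L (algebraMap (𝓞 K) K a), algebraMap K L (algebraMap (𝓞 K) K b)] := by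
    ext i
    fin_cases i <;> rfl
  rwa [hK, hL] at h

theorem logHeight₁_algebraMap (x : K) :
    logHeight₁ (algebraMap K L x) = Module.finrank K L * logHeight₁ x := by
  rw [logHeight₁_eq_log_mulHeight₁, mulHeight₁_algebraMap, Real.log_pow,
    ← logHeight₁_eq_log_mulHeight₁]

/-- The absolute height can be computed in any number field. -/
theorem absLogHeight₁_algebraMap {Ω : Type*} [Field Ω] [CharZero Ω] [Algebra K Ω] (x : K) :
    absLogHeight₁ (algebraMap K Ω x) = logHeight₁ x / Module.finrank ℚ K := by
  have hx : IsIntegral ℚ (algebraMap K Ω x) :=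
    (Algebra.IsIntegral.isIntegral (R := ℚ) x).algebraMap
  have : FiniteDimensional ℚ (IntermediateField.adjoin ℚ {algebraMap K Ω x}) :=
    IntermediateField.adjoin.finiteDimensional hx
  have : NumberField (IntermediateField.adjoin ℚ {algebraMap K Ω x}) := {}
  have hle : IntermediateField.adjoin ℚ {algebraMap K Ω x} ≤
      (IsScalarTower.toAlgHom ℚ K Ω).fieldRange := by
    rw [IntermediateField.adjoin_simple_le_iff]
    exact ⟨x, rfl⟩
  let e := AlgEquiv.ofInjectiveField (IsScalarTower.toAlgHom ℚ K Ω)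
  let j : IntermediateField.adjoin ℚ {algebraMap K Ω x} →+* K :=
    e.symm.toRingHom.comp (IntermediateField.inclusion hle).toRingHom
  let : Algebra (IntermediateField.adjoin ℚ {algebraMap K Ω x}) K := j.toAlgebra
  have hj : algebraMap _ K (IntermediateField.AdjoinSimple.gen ℚ (algebraMap K Ω x)) = x := by
    change e.symm _ = x
    rw [AlgEquiv.symm_apply_eq]
    rfl
  have h := logHeight₁_algebraMap (L := K) (IntermediateField.AdjoinSimple.gen ℚ (algebraMap K Ω x))
  rw [hj] at h
  have hfin := Module.finrank_mul_finrank ℚ (IntermediateField.adjoin ℚ {algebraMap K Ω x}) K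
  have h1 : (0 : ℝ) < Module.finrank ℚ (IntermediateField.adjoin ℚ {algebraMap K Ω x}) := by
    exact_mod_cast Module.finrank_pos
  have h2 : (0 : ℝ) < Module.finrank (IntermediateField.adjoin ℚ {algebraMap K Ω x}) K := by
    have : Module.Finite (IntermediateField.adjoin ℚ {algebraMap K Ω x}) K :=
      Module.Finite.of_restrictScalars_finite ℚ _ _
    exact_mod_cast Module.finrank_pos
  rw [absLogHeight₁, absMulHeight₁, dif_pos hx, Real.log_rpow (mulHeight₁_pos _),
    ← logHeight₁_eq_log_mulHeight₁, h, ← hfin]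
  push_cast
  field_simp

end NumberField

/-! ### The addition-subtraction map on x-coordinates -/

namespace WeierstrassCurve.Affine.Point

open MvPolynomial

variable {F : Type*} [Field F] [DecidableEq F] {W : WeierstrassCurve F}

theorem addSubMap_sym2x_self [W.IsElliptic] (P : W.toAffine.Point) :
    ∃ c : F, c ≠ 0 ∧ (fun i ↦ (addSubMap W i).eval (P.sym2x P)) = c • (P + P).sym2x 0 := by
  have hne := addSubMap_ne_zero W (sym2x_ne_zero P P)
  match P with
  | .zero =>
    refine ⟨1, one_ne_zero, ?_⟩
    rw [← zero_def, add_zero, one_smul]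
    ext i
    fin_cases i <;> simp [addSubMap]
  | .some x y h =>
    have heq := (equation_iff _ _).mp h.1
    by_cases hy : y = W.toAffine.negY x y
    · rw [add_self_of_Y_eq hy]
      have h6 : W.a₆ = y ^ 2 + W.a₁ * x * y + W.a₃ * y - (x ^ 3 + W.a₂ * x ^ 2 + W.a₄ * x) := by
        linear_combination -heq
      have h1 : (addSubMap W 1).eval ((some x y h).sym2x (some x y h)) = 0 := by
        have : (y - W.toAffine.negY x y) ^ 2 = 0 := by rw [sub_eq_zero.mpr hy, sq, zero_mul]
        rw [← this]
        simp [addSubMap, b₂, b₄, b₆, negY, h6]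
        ring
      have h2 : (addSubMap W 2).eval ((some x y h).sym2x (some x y h)) = 0 := by
        simp [addSubMap]
        ring
      -- Here `P + P = 0`, so only coordinate `0` survives; it is nonzero because the map has no
      -- zero at `P.sym2x P`.
      refine ⟨(addSubMap W 0).eval ((some x y h).sym2x (some x y h)), fun h0 ↦ hne ?_, ?_⟩
      · ext i
        fin_cases i
        exacts [h0, h1, h2]
      · rw [sym2x_zero_zero]
        ext i
        fin_cases i
        · simp
        · simpa using h1
        · simpa using h2
    · have h6 : W.a₆ = y ^ 2 + W.a₁ * x * y + W.a₃ * y - (x ^ 3 + W.a₂ * x ^ 2 + W.a₄ * x) := by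
        linear_combination -heq
      have hy' : y - W.toAffine.negY x y ≠ 0 := sub_ne_zero.mpr hy
      refine ⟨(y - W.toAffine.negY x y) ^ 2, pow_ne_zero _ hy', ?_⟩
      rw [add_self_of_Y_ne hy, sym2x_some_zero, sym2x_some_some, slope_of_Y_ne rfl hy]
      have hd : y - W.toAffine.negY x y = 2 * y + W.a₁ * x + W.a₃ := by
        rw [negY]
        ring
      generalize y - W.toAffine.negY x y = d at hy' hd ⊢
      ext i
      fin_cases i
      · simp [addSubMap, addX]
        field_simp
        simp only [hd, b₄, b₆, b₈, h6]
        ring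
      · simp [addSubMap, b₂, b₄, b₆, h6, hd]
        ring
      · simp [addSubMap]
        ring

/-- The unordered pair $x(P+Q),x(P-Q)$ is a quadratic function of the pair $x(P),x(Q)$. The scalar
is harmless because heights are projective. -/
theorem addSubMap_sym2x [W.IsElliptic] (P Q : W.toAffine.Point) :
    ∃ c : F, c ≠ 0 ∧
      (fun i ↦ (addSubMap W i).eval (P.sym2x Q)) = c • (P + Q).sym2x (P - Q) := by
  by_cases hPQ : P.xRep = Q.xRep
  · obtain rfl | rfl := eq_or_eq_neg_of_xRep_eq_xRep hPQ
    · rw [sub_self]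
      exact addSubMap_sym2x_self P
    · rw [sym2x_neg_left, neg_add_cancel, ← neg_add', sym2x_neg_right, sym2x_comm 0]
      exact addSubMap_sym2x_self Q
  match P, Q with
  | .zero, .zero => exact absurd rfl hPQ
  | .zero, .some x y h =>
    refine ⟨1, one_ne_zero, ?_⟩
    rw [← zero_def, zero_add, zero_sub, one_smul, sym2x_neg_right]
    ext i
    fin_cases i <;> simp [addSubMap] <;> ring
  | .some x y h, .zero =>
    refine ⟨1, one_ne_zero, ?_⟩
    rw [← zero_def, add_zero, sub_zero, one_smul]
    ext i
    fin_cases i <;> simp [addSubMap] <;> ring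
  | .some x₁ y₁ h₁, .some x₂ y₂ h₂ =>
    have hx : x₁ ≠ x₂ := by simpa using hPQ
    have hx' : x₁ - x₂ ≠ 0 := sub_ne_zero.mpr hx
    have heq₁ := (equation_iff _ _).mp h₁.1
    have heq₂ := (equation_iff _ _).mp h₂.1
    have h6 : W.a₆ = y₁ ^ 2 + W.a₁ * x₁ * y₁ + W.a₃ * y₁ -
        (x₁ ^ 3 + W.a₂ * x₁ ^ 2 + W.a₄ * x₁) := by
      linear_combination -heq₁
    -- The two curve equations are solved for `W.a₆` and `W.a₄`, leaving a rational identity in free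
    -- variables.
    have h4 : W.a₄ = (y₁ ^ 2 + W.a₁ * x₁ * y₁ + W.a₃ * y₁ - (x₁ ^ 3 + W.a₂ * x₁ ^ 2) -
        (y₂ ^ 2 + W.a₁ * x₂ * y₂ + W.a₃ * y₂ - (x₂ ^ 3 + W.a₂ * x₂ ^ 2))) / (x₁ - x₂) := by
      rw [eq_div_iff hx']
      linear_combination heq₂ - heq₁
    refine ⟨(x₁ - x₂) ^ 2, pow_ne_zero _ hx', ?_⟩
    rw [sub_eq_add_neg (some x₁ y₁ h₁), neg_some, add_of_X_ne hx, add_of_X_ne hx, sym2x_some_some,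
      sym2x_some_some, slope_of_X_ne hx, slope_of_X_ne hx]
    ext i
    fin_cases i
    · simp [addSubMap, addX, b₂, b₄, b₆, b₈, negY, h6, h4]
      field_simp
      ring
    · simp [addSubMap, addX, b₂, b₄, b₆, b₈, negY, h6, h4]
      field_simp
      ring
    · simp [addSubMap]
      ring

open Height in
/-- The **approximate parallelogram law** for the naive height. -/
theorem exists_abs_logHeight_xRep_parallelogram_le [AdmissibleAbsValues F] [W.IsElliptic] :
    ∃ C : ℝ, ∀ P Q : W.toAffine.Point,
      |logHeight (P + Q).xRep + logHeight (P - Q).xRep -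
        2 * (logHeight P.xRep + logHeight Q.xRep)| ≤ C := by
  obtain ⟨C₁, hC₁⟩ := abs_logHeight_addSubMap_sub_two_mul_logHeight_le W
  obtain ⟨C₂, hC₂⟩ := abs_logHeight_sym2_sub_le F
  have hsym (P Q : W.toAffine.Point) :
      |logHeight (P.sym2x Q) - (logHeight P.xRep + logHeight Q.xRep)| ≤ C₂ := by
    have hvec (v : Fin 2 → F) : v = ![v 0, v 1] := by
      ext i
      fin_cases i <;> rfl
    have h := hC₂ (a := P.xRep 0) (b := P.xRep 1) (c := Q.xRep 0) (d := Q.xRep 1)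
    rw [← hvec, ← hvec] at h
    exact h P.xRep_ne_zero Q.xRep_ne_zero
  -- One `C₂` comes from the pair `P + Q`, `P - Q`, and two from `P`, `Q`, whose height is doubled.
  refine ⟨C₁ + 3 * C₂, fun P Q ↦ ?_⟩
  obtain ⟨c, hc, h⟩ := addSubMap_sym2x P Q
  have h₁ := hC₁ (P.sym2x Q)
  rw [h, logHeight_smul_eq_logHeight _ hc] at h₁
  have h₂ := hsym P Q
  have h₃ := hsym (P + Q) (P - Q)
  rw [abs_le] at *
  constructor <;> linarith [h₁.1, h₁.2, h₂.1, h₂.2, h₃.1, h₃.2]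

end WeierstrassCurve.Affine.Point

/-! ### Canonical heights from approximate parallelogram laws -/

open Filter Topology

section Parallelogram

variable {A : Type*} [AddCommGroup A]

/-- A function satisfying the parallelogram law is homogeneous of degree two. -/
theorem zsmul_eq_sq_mul_of_parallelogram {f : A → ℝ}
    (hf : ∀ x y, f (x + y) + f (x - y) = 2 * (f x + f y)) (n : ℤ) (x : A) :
    f (n • x) = |(n : ℝ)| ^ 2 * f x := by
  have h0 : f 0 = 0 := by
    have := hf 0 0
    simp only [add_zero, sub_zero] at this
    linarith
  have hneg (y : A) : f (-y) = f y := by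
    have := hf 0 y
    simp only [zero_add, zero_sub, h0] at this
    linarith
  have hnat (n : ℕ) : f (n • x) = (n : ℝ) ^ 2 * f x := by
    induction n using Nat.twoStepInduction with
    | zero => simp [h0]
    | one => simp
    | more n ih₁ ih₂ =>
      have h := hf ((n + 1) • x) x
      rw [← succ_nsmul, succ_nsmul x n, add_sub_cancel_right, ← succ_nsmul x n, ih₁, ih₂] at h
      push_cast at h ⊢
      linarith
  rw [sq_abs]
  obtain ⟨m, rfl | rfl⟩ := n.eq_nat_or_neg
  · simpa using hnat m
  · simpa [hneg] using hnat m

/-- The parallelogram law for `h` holds up to a bounded error locally, that is, on subgroups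
containing any two given elements. -/
def LocallyApproxParallelogram (h : A → ℝ) : Prop :=
  ∀ x y : A, ∃ S : AddSubgroup A, x ∈ S ∧ y ∈ S ∧ ∃ C : ℝ, ∀ u ∈ S, ∀ v ∈ S,
    |h (u + v) + h (u - v) - 2 * (h u + h v)| ≤ C

variable {h : A → ℝ}

theorem LocallyApproxParallelogram.tendsto_limUnder (hh : LocallyApproxParallelogram h) (x : A) :
    Tendsto (fun n : ℕ ↦ h ((2 ^ n : ℕ) • x) / 4 ^ n) atTop
      (𝓝 (limUnder atTop fun n : ℕ ↦ h ((2 ^ n : ℕ) • x) / 4 ^ n)) := by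
  obtain ⟨S, hx, -, C, hC⟩ := hh x x
  -- Tate's telescoping: the law at `u = v = 2 ^ n • x` bounds the successive differences, with `h
  -- 0` from `u - v` absorbed into the constant.
  refine (cauchySeq_of_le_geometric (1 / 4) ((C + |h 0|) / 4) (by norm_num)
    fun n ↦ ?_).tendsto_limUnder
  have hS : (2 ^ n : ℕ) • x ∈ S := S.nsmul_mem hx _
  have h1 := hC _ hS _ hS
  rw [sub_self, ← two_nsmul, ← mul_nsmul', ← pow_succ'] at h1
  have h2 : |h ((2 ^ (n + 1) : ℕ) • x) - 4 * h ((2 ^ n : ℕ) • x)| ≤ C + |h 0| := by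
    have := abs_le.mp h1
    have h3 := neg_abs_le (h 0)
    have h4 := le_abs_self (h 0)
    rw [abs_le]
    constructor <;> linarith
  have h4 : (0 : ℝ) < 4 ^ n := by positivity
  rw [dist_comm, Real.dist_eq, pow_succ (4 : ℝ)]
  have : h ((2 ^ (n + 1) : ℕ) • x) / (4 ^ n * 4) - h ((2 ^ n : ℕ) • x) / 4 ^ n =
      (h ((2 ^ (n + 1) : ℕ) • x) - 4 * h ((2 ^ n : ℕ) • x)) / (4 ^ n * 4) := by
    field_simp
  rw [this, abs_div, abs_of_pos (by positivity : (0 : ℝ) < 4 ^ n * 4), div_pow, one_pow,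
    div_mul_div_comm, mul_one, mul_comm (4 ^ n : ℝ)]
  gcongr

/-- The canonical height attached to `h` satisfies the parallelogram law. -/
theorem LocallyApproxParallelogram.limUnder_parallelogram (hh : LocallyApproxParallelogram h)
    {f : A → ℝ} (hf : ∀ x, f x = limUnder atTop fun n : ℕ ↦ h ((2 ^ n : ℕ) • x) / 4 ^ n)
    (x y : A) : f (x + y) + f (x - y) = 2 * (f x + f y) := by
  have ht (x : A) : Tendsto (fun n : ℕ ↦ h ((2 ^ n : ℕ) • x) / 4 ^ n) atTop (𝓝 (f x)) := by
    rw [hf]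
    exact hh.tendsto_limUnder x
  obtain ⟨S, hx, hy, C, hC⟩ := hh x y
  have h1 := ((ht (x + y)).add (ht (x - y))).sub (((ht x).add (ht y)).const_mul 2)
  have h2 : Tendsto (fun n : ℕ ↦ C * (1 / 4 : ℝ) ^ n) atTop (𝓝 (C * 0)) :=
    (tendsto_pow_atTop_nhds_zero_of_lt_one (by norm_num) (by norm_num)).const_mul C
  rw [mul_zero] at h2
  have h3 := tendsto_nhds_unique h1 (squeeze_zero_norm (fun n ↦ ?_) h2)
  · linarith
  have h4 : (0 : ℝ) < 4 ^ n := by positivity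
  have h5 := hC _ (S.nsmul_mem hx (2 ^ n)) _ (S.nsmul_mem hy (2 ^ n))
  rw [← nsmul_add, ← nsmul_sub] at h5
  rw [Real.norm_eq_abs, ← add_div, ← add_div, mul_div_assoc', ← sub_div, abs_div, abs_of_pos h4,
    div_pow, one_pow, mul_one_div]
  gcongr

end Parallelogram

/-! ### The absolute height on algebraic numbers -/

open Filter Topology NumberField Height

namespace NumberField

theorem absLogHeight₁_nonneg {Ω : Type*} [Field Ω] [CharZero Ω] (x : Ω) : 0 ≤ absLogHeight₁ x := by
  rw [absLogHeight₁, absMulHeight₁]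
  split_ifs with hx
  · have : FiniteDimensional ℚ (IntermediateField.adjoin ℚ {x}) :=
      IntermediateField.adjoin.finiteDimensional hx
    have : NumberField (IntermediateField.adjoin ℚ {x}) := {}
    exact Real.log_nonneg (Real.one_le_rpow (one_le_mulHeight₁ _) (by positivity))
  · simp

/-- Finitely many algebraic numbers lie in a common number field. -/
theorem exists_numberField_intermediateField {K Ω : Type*} [Field K] [NumberField K] [Field Ω]
    [Algebra K Ω] [Algebra.IsAlgebraic K Ω] (s : Finset Ω) :
    ∃ L : IntermediateField K Ω, NumberField L ∧ ∀ x ∈ s, x ∈ L := by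
  have : FiniteDimensional K (IntermediateField.adjoin K (s : Set Ω)) :=
    IntermediateField.finiteDimensional_adjoin fun x _ ↦ Algebra.IsIntegral.isIntegral x
  exact ⟨IntermediateField.adjoin K (s : Set Ω), NumberField.of_module_finite K _,
    fun x hx ↦ IntermediateField.subset_adjoin K _ hx⟩

variable {Ω : Type*} [Field Ω] [CharZero Ω] [Algebra.IsAlgebraic ℚ Ω]

theorem absLogHeight₁_mul_le (x y : Ω) :
    absLogHeight₁ (x * y) ≤ absLogHeight₁ x + absLogHeight₁ y := by
  classical
  obtain ⟨L, _, hL⟩ := exists_numberField_intermediateField (K := ℚ) {x, y}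
  lift x to L using hL x (by simp)
  lift y to L using hL y (by simp)
  have h (z : L) := absLogHeight₁_algebraMap (Ω := Ω) z
  simp only [IntermediateField.algebraMap_apply] at h
  rw [← IntermediateField.coe_mul, h, h, h, ← add_div]
  gcongr
  exact logHeight₁_mul_le x y

theorem absLogHeight₁_zpow (x : Ω) (n : ℤ) :
    absLogHeight₁ (x ^ n) = |(n : ℝ)| * absLogHeight₁ x := by
  classical
  obtain ⟨L, _, hL⟩ := exists_numberField_intermediateField (K := ℚ) {x}
  lift x to L using hL x (by simp)
  have h (z : L) := absLogHeight₁_algebraMap (Ω := Ω) z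
  simp only [IntermediateField.algebraMap_apply] at h
  have hpow : (x : Ω) ^ n = ((x ^ n : L) : Ω) := rfl
  rw [hpow, h, h, logHeight₁_zpow, Nat.cast_natAbs, Int.cast_abs, mul_div_assoc]

end NumberField

/-! ### The Néron–Tate height -/

section Elliptic

variable {K Ω : Type*} [Field K] [NumberField K] [Field Ω] [CharZero Ω] [Algebra K Ω]

theorem naiveHeight_nonneg {Ω : Type*} [Field Ω] [CharZero Ω] {W : WeierstrassCurve Ω}
    (P : W.toAffine.Point) : 0 ≤ naiveHeight P := by
  cases P
  · exact le_rfl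
  · exact absLogHeight₁_nonneg _

variable [DecidableEq Ω]

open WeierstrassCurve.Affine in
theorem naiveHeight_map (E : WeierstrassCurve K) (L : IntermediateField K Ω) [NumberField L]
    (P : (E.baseChange L).toAffine.Point) :
    naiveHeight (Point.map (W' := E) L.val P) = logHeight P.xRep / Module.finrank ℚ L := by
  match P with
  | .zero =>
    rw [← Point.zero_def, Point.map_zero, Point.xRep_zero]
    simp [naiveHeight]
  | .some x y h =>
    rw [Point.map_some, Point.xRep_some, ← logHeight₁_eq_logHeight]
    exact absLogHeight₁_algebraMap (Ω := Ω) x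

-- Two points are defined over a common number field `L`; the error constant may depend on `L`,
-- which is why the law is only local.
open WeierstrassCurve.Affine in
theorem locallyApproxParallelogram_naiveHeight [Algebra.IsAlgebraic K Ω] (E : WeierstrassCurve K)
    [E.IsElliptic] :
    LocallyApproxParallelogram
      (naiveHeight : (E.baseChange Ω).toAffine.Point → ℝ) := by
  have hlift (P : (E.baseChange Ω).toAffine.Point) : ∃ s : Finset Ω, ∀ L : IntermediateField K Ω,
      (∀ x ∈ s, x ∈ L) → P ∈ (Point.map (W' := E) L.val).range := by
    match P with
    | .zero => exact ⟨∅, fun L _ ↦ zero_mem _⟩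
    | .some x y h =>
      refine ⟨{x, y}, fun L hL ↦ ?_⟩
      lift x to L using hL x (by simp)
      lift y to L using hL y (by simp)
      exact ⟨.some x y ((E.toAffine.baseChange_nonsingular L.val.injective x y).mp h), rfl⟩
  intro P Q
  obtain ⟨s, hs⟩ := hlift P
  obtain ⟨t, ht⟩ := hlift Q
  obtain ⟨L, _, hL⟩ := exists_numberField_intermediateField (K := K) (s ∪ t)
  refine ⟨_, hs L fun x hx ↦ hL x (by simp [hx]), ht L fun x hx ↦ hL x (by simp [hx]), ?_⟩
  have : (E.baseChange L).IsElliptic := inferInstanceAs (E.map (algebraMap K L)).IsElliptic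
  obtain ⟨C, hC⟩ := Point.exists_abs_logHeight_xRep_parallelogram_le (W := E.baseChange L)
  refine ⟨C / Module.finrank ℚ L, ?_⟩
  rintro _ ⟨u, rfl⟩ _ ⟨v, rfl⟩
  rw [← map_add, ← map_sub]
  simp only [naiveHeight_map]
  rw [← add_div, ← add_div, mul_div_assoc', ← sub_div, abs_div, Nat.abs_cast]
  gcongr
  exact hC u v

variable [Algebra.IsAlgebraic K Ω] (E : WeierstrassCurve K) [E.IsElliptic]

theorem neronTateHeight_parallelogram (P Q : (E.baseChange Ω).toAffine.Point) :
    neronTateHeight (P + Q) + neronTateHeight (P - Q) =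
      2 * (neronTateHeight P + neronTateHeight Q) :=
  (locallyApproxParallelogram_naiveHeight E).limUnder_parallelogram (fun _ ↦ rfl) P Q

theorem neronTateHeight_nonneg (P : (E.baseChange Ω).toAffine.Point) :
    0 ≤ neronTateHeight P :=
  ge_of_tendsto' ((locallyApproxParallelogram_naiveHeight E).tendsto_limUnder P)
    fun _ ↦ div_nonneg (naiveHeight_nonneg _) (by positivity)

end Elliptic

/-! ### Countability and the two cases of the theorem -/

instance WeierstrassCurve.Affine.Point.countable {F : Type*} [CommRing F] [Countable F]
    (W : WeierstrassCurve F) : Countable W.toAffine.Point := by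
  refine Function.Injective.countable
    (f := fun P : W.toAffine.Point ↦ match P with
      | .zero => (none : Option (F × F))
      | .some x y _ => Option.some (x, y)) ?_
  rintro (_ | _) (_ | _) h <;> simp_all

theorem proposition1p1 {K Qbar : Type*} [Field K] [NumberField K]
    [Field Qbar] [CharZero Qbar] [IsAlgClosure ℚ Qbar] [DecidableEq Qbar] [Algebra K Qbar]
    (F : IntermediateField K Qbar) :
    (BogomolovGm F → Module.Free ℤ (Additive (Fˣ ⧸ CommGroup.torsion Fˣ))) ∧
    (∀ E : WeierstrassCurve K, E.IsElliptic → BogomolovElliptic E F →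
      Module.Free ℤ ((E.baseChange F).toAffine.Point ⧸
        AddCommGroup.torsion (E.baseChange F).toAffine.Point)) := by
  have : Algebra.IsAlgebraic ℚ Qbar := IsAlgClosure.isAlgebraic
  have : Algebra.IsAlgebraic K Qbar := Algebra.IsAlgebraic.tower_top (K := ℚ) K
  have : Countable Qbar := by
    have h := Algebraic.countable ℚ Qbar
    rw [Set.eq_univ_of_forall (s := {x : Qbar | IsAlgebraic ℚ x})
      fun x ↦ Algebra.IsAlgebraic.isAlgebraic x] at h
    exact Set.countable_univ_iff.mp h
  have : Countable F := Subtype.countable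
  constructor
  · rintro ⟨ε, hε, h⟩
    have : Countable Fˣ := Function.Injective.countable (f := Units.val) fun _ _ ↦ Units.ext
    have : Countable (Additive Fˣ) := Additive.toMul.injective.countable
    refine Module.free_of_discrete_height (G := Additive Fˣ) (C := 1) (k := 1)
      (N := fun u ↦ absLogHeight₁ (((u.toMul : Fˣ) : F) : Qbar))
      (QuotientGroup.mk' (CommGroup.torsion Fˣ)).toAdditive
      (QuotientGroup.mk'_surjective (CommGroup.torsion Fˣ)) ?_ le_rfl hε one_ne_zero
      (fun _ ↦ absLogHeight₁_nonneg _) ?_ ?_ ?_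
    · intro u hu
      have hu' : u.toMul ∈ CommGroup.torsion Fˣ := (QuotientGroup.eq_one_iff u.toMul).mp hu
      exact (isOfFinAddOrder_ofMul_iff (x := u.toMul)).mpr hu'
    · intro u v
      rw [one_mul]
      simpa using absLogHeight₁_mul_le (u.toMul.1 : Qbar) v.toMul.1
    · intro n u
      have hpow : (((n • u).toMul.1 : F) : Qbar) = (u.toMul.1 : Qbar) ^ n := by
        rw [toMul_zsmul, Units.val_zpow_eq_zpow_val]
        rfl
      rw [hpow, pow_one]
      exact absLogHeight₁_zpow _ n
    · intro u hu
      exact h u.toMul fun hu' ↦ hu ((QuotientGroup.eq_one_iff u.toMul).mpr hu')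
  · rintro E hE ⟨ε, hε, h⟩
    have hpar := neronTateHeight_parallelogram (Ω := Qbar) E
    refine Module.free_of_discrete_height (C := 2) (k := 2)
      (N := fun P ↦ neronTateHeight (WeierstrassCurve.Affine.Point.map (W' := E) F.val P))
      (QuotientAddGroup.mk' (AddCommGroup.torsion (E.baseChange F).toAffine.Point))
      (QuotientAddGroup.mk'_surjective _) ?_ one_le_two hε two_ne_zero
      (fun _ ↦ neronTateHeight_nonneg E _) ?_ ?_ ?_
    · exact fun P hP ↦ (QuotientAddGroup.eq_zero_iff P).mp hP
    · intro P Q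
      rw [map_add]
      -- Dropping the nonnegative height of `P - Q` from the parallelogram law gives the constant
      -- `2`.
      exact (le_add_of_nonneg_right (neronTateHeight_nonneg E _)).trans_eq (hpar _ _)
    · intro n P
      rw [map_zsmul]
      exact zsmul_eq_sq_mul_of_parallelogram hpar n _
    · exact fun P hP ↦ h P fun hP' ↦ hP ((QuotientAddGroup.eq_zero_iff P).mpr hP')
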